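/- Status updates are generated every $1/\lambda_0$ seconds. Update $n$ has system delay $D_n=T_n+D_n^{[0]}+D_n^{[i]}$: a transmission time $T_n=\Phi_n/S_n$ (packet volume $\Phi_n\ge 0$ over semantic rate $S_n>0$) with finite mean $\mathbb E[\Phi_n/S_n]$ not depending on $n$; the delay $D_n^{[0]}$ in a scheduler; and the delay $D_n^{[i]}$ in server $i$, where $i=1$ if the update is of Category I (semantic similarity $\xi_n\ge\hat\xi$) and $i=2$ if it is of Category II ($\xi_n<\hat\xi$). A delay in a component is waiting time plus service time. The scheduler is a first-come-first-served D/M/1 queue in steady state with inter-arrival time $1/\lambda_0$ and service rate $\mu_0$, $0<\lambda_0<\mu_0$. Server $i$ is modelled as a first-come-first-served G/M/1 queue in steady state with i.i.d. inter-arrival times of an arbitrary law $G_i$ on $[0,\infty)$ of mean $1/\lambda_i$ and with service rate $\mu_i$, $0<\lambda_i<\mu_i$. Categories I and II occur with probabilities $a$ and $b$, $a+b=1$, and the category of an update is independent of its delay in server $1$ and of its delay in server $2$. For system delays $D_n$ and inter-generation times $G_n=1/\lambda_0$, the average age of information (AoI) is $\mathbb E[Q_n]/\mathbb E[G_n]$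 with $Q_n=\frac12(G_n+D_n)^2-\frac12D_n^2$. Let $\overline\Delta^{[i]}$ be the average AoI of updates served by server $i$ (system delay $T_n+D^{[0]}_n+D^{[i]}_n$), and $\overline\Delta$ the average AoI over all updates, each one being served according to its category. Put $\rho_0=\lambda_0/\mu_0$, let $\mathcal W$ be the principal branch of the Lambert $W$ function, and let $\eta_i$ be the smallest real root of $\eta=\mathcal L_{G_i}(\mu_i(1-\eta))$, where $\mathcal L_{G_i}(s)=\int e^{-sx}\,dG_i(x)$. Then $\eta_i$ exists, $\eta_i<1$, all the delays are integrable, $$\mathbb E[D_n^{[0]}]=\frac1{\mu_0}+\frac1{\mu_0}\cdot\frac{-\rho_0\mathcal W(-\frac1{\rho_0}e^{-1/\rho_0})}{1+\rho_0\mathcal W(-\frac1{\rho_0}e^{-1/\rho_0})},\qquad \mathbb E[D_n^{[i]}]=\frac1{\mu_i}+\frac{\eta_i}{\mu_i(1-\eta_i)}\quad(i=1,2),$$ $$\overline\Delta^{[i]}=\frac1{2\lambda_0}+\mathbb E\Big[\frac{\Phi_n}{S_n}\Big]+\mathbb E[D_n^{[0]}]+\mathbb E[D_n^{[i]}]=\frac1{2\lambda_0}+\mathbb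 E\Big[\frac{\Phi_n}{S_n}\Big]+\frac{\mu_0+\mu_i}{\mu_0\mu_i}+\frac1{\mu_0}\cdot\frac{-\rho_0\mathcal W(-\frac1{\rho_0}e^{-1/\rho_0})}{1+\rho_0\mathcal W(-\frac1{\rho_0}e^{-1/\rho_0})}+\frac{\eta_i}{\mu_i(1-\eta_i)},$$ and $\overline\Delta=a\,\overline\Delta^{[1]}+b\,\overline\Delta^{[2]}$. Moreover, for each of these three streams of updates (all served by server $1$; all served by server $2$; each served according to its category): if almost surely the updates leave the system in the order of generation and $\frac1N\sum_{n=1}^{N}Q_n\to\mathbb E[Q_n]$, then almost surely the time average $\frac1{\mathcal T}\int_0^{\mathcal T}A(t)\,dt$ of the age $A(t)$ (the time elapsed at $t$ since the generation of the latest update received by time $t$; $A(t)=t$ before the first reception) converges, as $\mathcal T\to\infty$, to $\overline\Delta^{[1]}$, $\overline\Delta^{[2]}$, $\overline\Delta$ respectively. -/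

import Mathlib

open MeasureTheory ProbabilityTheory Filter Topology

noncomputable section

namespace AoI

/-- The principal real branch of the Lambert `W` function: the inverse of `w ↦ w * exp w`
restricted to `[-1, ∞)`. -/
def lambertW (x : ℝ) : ℝ :=
  Function.invFunOn (fun w : ℝ => w * Real.exp w) (Set.Ici (-1)) x

/-- The Laplace transform `s ↦ E[exp (-s X)]` of a distribution `G` on the line. -/
def laplace (G : Measure ℝ) (s : ℝ) : ℝ := ∫ x, Real.exp (-(s * x)) ∂G

/-- The set of real roots `x` of `x = L_G (μ (1 - x))`. -/
def rootSet (G : Measure ℝ) (μ : ℝ) : Set ℝ := {x | x = laplace G (μ * (1 - x))}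

/-- The smallest root of `x = L_G (μ (1 - x))`. -/
def smallestRoot (G : Measure ℝ) (μ : ℝ) : ℝ := sInf (rootSet G μ)

/-- A first-come-first-served single-server G/M/1 queue in steady state.
`A n` is the time between the arrivals of packets `n` and `n + 1`, `H n` is the service time of
packet `n`, and `W n` is its waiting time. The inter-arrival times are i.i.d. with law `G`, the
service times are i.i.d. exponential with rate `μ`, the two sequences and the initial waiting time
are independent, the waiting times follow the Lindley recursion, and their law does not depend
on the packet. -/
structure IsSteadyGM1 {Ω : Type*} [MeasurableSpace Ω] (P : Measure Ω) (G : Measure ℝ) (μ : ℝ)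
    (A H W : ℕ → Ω → ℝ) : Prop where
  measurable_A : ∀ n, Measurable (A n)
  measurable_H : ∀ n, Measurable (H n)
  measurable_W : ∀ n, Measurable (W n)
  law_A : ∀ n, P.map (A n) = G
  law_H : ∀ n, P.map (H n) = expMeasure μ
  indep_A_H : ∀ n, IndepFun (A n) (H n) P
  indep_packets : iIndepFun (fun n ω => (A n ω, H n ω)) P
  indep_initial : IndepFun (W 0) (fun ω n => (A n ω, H n ω)) P
  initial_nonneg : ∀ ω, 0 ≤ W 0 ω
  lindley : ∀ n ω, W (n + 1) ω = max 0 (W n ω + H n ω - A n ω)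
  steady : ∀ n, P.map (W n) = P.map (W 0)

/-- A D/M/1 queue in steady state with arrival rate `lam`, that is, a G/M/1 queue
whose inter-arrival times are all equal to `1 / lam`. -/
def IsSteadyDM1 {Ω : Type*} [MeasurableSpace Ω] (P : Measure Ω) (lam μ : ℝ)
    (H W : ℕ → Ω → ℝ) : Prop :=
  IsSteadyGM1 P (Measure.dirac (1 / lam)) μ (fun _ _ => 1 / lam) H W

/-- The delay (waiting time plus service time) in one component. -/
def sojourn {Ω : Type*} (W H : ℕ → Ω → ℝ) (n : ℕ) (ω : Ω) : ℝ := W n ω + H n ω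

/-- The category of an update with semantic similarity `x`, for the category boundary `ξhat`:
`0` stands for Category I (`x ≥ ξhat`), `1` for Category II (`x < ξhat`). -/
def category (ξhat x : ℝ) : Fin 2 := if ξhat ≤ x then 0 else 1

/-- Generation moment of update `n`, for generation rate `lam`. -/
def genTime (lam : ℝ) (n : ℕ) : ℝ := n / lam

/-- The time between the generation of updates `n` and `n + 1`. -/
def genInterval (lam : ℝ) (n : ℕ) : ℝ := genTime lam (n + 1) - genTime lam n

/-- The area `Q` that an update with system delay `d`, generated `g` after the
previous one, contributes to the area under the age curve. -/
def polygonArea (g d : ℝ) : ℝ := (g + d) ^ 2 / 2 - d ^ 2 / 2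

/-- The expectation `E[Q]` for update `n + 1`, if `D` are the system delays. -/
def meanArea {Ω : Type*} [MeasurableSpace Ω] (P : Measure Ω) (lam : ℝ) (D : ℕ → Ω → ℝ)
    (n : ℕ) : ℝ :=
  ∫ ω, polygonArea (genInterval lam n) (D (n + 1) ω) ∂P

/-- The average age of information `E[Q] / E[G]` at update `n + 1`, if updates are
generated with rate `lam` and have system delays `D`. -/
def averageAoI {Ω : Type*} [MeasurableSpace Ω] (P : Measure Ω) (lam : ℝ) (D : ℕ → Ω → ℝ)
    (n : ℕ) : ℝ :=
  meanArea P lam D n / ∫ _ω, genInterval lam n ∂P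

/-- The instantaneous age at time `t`: the time elapsed since the generation of the latest of the
updates received by time `t`, where update `n` is generated at `α n` and received at `β n`.
(Before the first reception the age is `t`.) -/
def age (α β : ℕ → ℝ) (t : ℝ) : ℝ := t - sSup {x | ∃ n, β n ≤ t ∧ x = α n}

/-- Moment at which update `n` leaves the system, if `d` are the system delays. -/
def departure (lam : ℝ) (d : ℕ → ℝ) (n : ℕ) : ℝ := genTime lam n + d n

/-- The time average of the age over `[0, τ]`, if `d` are the system delays. -/
def timeAverageAge (lam : ℝ) (d : ℕ → ℝ) (τ : ℝ) : ℝ :=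
  (1 / τ) * ∫ t in (0 : ℝ)..τ, age (genTime lam) (departure lam d) t

/-- Updates almost surely leave the system in the order of their generation. -/
def DeparturesOrdered {Ω : Type*} [MeasurableSpace Ω] (P : Measure Ω) (lam : ℝ)
    (D : ℕ → Ω → ℝ) : Prop :=
  ∀ᵐ ω ∂P, Monotone (departure lam fun n => D n ω)

/-- The areas `Q` are ergodic: almost surely their empirical mean tends to `E[Q]`. -/
def AreasErgodic {Ω : Type*} [MeasurableSpace Ω] (P : Measure Ω) (lam : ℝ)
    (D : ℕ → Ω → ℝ) : Prop :=
  ∀ᵐ ω ∂P, Tendsto (fun N : ℕ =>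
      (1 / (N : ℝ)) * ∑ n ∈ Finset.range N, polygonArea (genInterval lam n) (D (n + 1) ω))
    atTop (𝓝 (meanArea P lam D 0))

/-- System delay of update `n` if it is served by a server with delays `Dserv`: the transmission
time (packet volume over semantic rate), plus the delay `Dsched` in the scheduler, plus the delay
in the server. -/
def systemDelay {Ω : Type*} (Φ S Dsched Dserv : ℕ → Ω → ℝ) (n : ℕ) (ω : Ω) : ℝ :=
  Φ n ω / S n ω + Dsched n ω + Dserv n ω

end AoI

end

namespace AoI

/-! The area Q equals g²/2 + g·d, so average AoI is 1/(2λ₀) plus the mean system delay. Everything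
in the formulas is therefore linear in mean delays, and the two categories mix with weights a and b
because the category is independent of each server delay.

The substance is the stationary G/M/1 waiting time. With X = H - A, its tail F satisfies F(x) = E
F(x - X) for x ≥ 0 (`measureReal_lt_W`) and F = 1 on x < 0. For every root η < 1, the function η
exp(-μ(1-η)x), set to 1 on x < 0, solves the same problem (`integral_waitingTail`). The absolute
difference of the two solutions is subharmonic for the walk and vanishes at infinity. Iterating
along x - Sₙ, which tends to +∞ by the strong law, forces it to be 0
(`le_zero_of_le_integral_walk`). Hence P(W > 0) = η, which also shows that there is only one root
below 1; no convexity of the Laplace transform is needed. For deterministic arrivals the root is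
explicit through Lambert W.

The time averages are pathwise: the integral of the age up to τ lies between two partial sums of the
areas, up to a bounded error, and both numbers of terms grow like λ₀τ (`tendsto_timeAverageAge`). -/

/-! ### The area under the age curve along one path. -/

lemma genInterval_eq (lam : ℝ) (n : ℕ) : genInterval lam n = 1 / lam := by
  simp only [genInterval, genTime]
  push_cast
  ring

/-- The squares of the delay cancel, so only first moments of delays are ever needed. -/
lemma polygonArea_eq (g d : ℝ) : polygonArea g d = g ^ 2 / 2 + g * d := by
  unfold polygonArea
  ring

/-- The generation time of the freshest received update counts the receptions. -/
lemma sSup_received_eq_sum {lam : ℝ} (hlam : 0 < lam) {β : ℕ → ℝ} (hβ : Monotone β)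
    (hge : ∀ n, genTime lam n ≤ β n) {t : ℝ} {K : ℕ} (hK : t < genTime lam (K + 1)) :
    sSup {x | ∃ n, β n ≤ t ∧ x = genTime lam n}
      = ∑ k ∈ Finset.range K, if β (k + 1) ≤ t then 1 / lam else 0 := by
  classical
  have hlt : ∀ n, K < n → t < β n := fun n hn =>
    hK.trans_le <| (hge (K + 1)).trans (hβ hn)
  by_cases h0 : β 0 ≤ t
  · set m := Nat.findGreatest (fun n => β n ≤ t) K with hm
    have hmK : m ≤ K := Nat.findGreatest_le K
    have hβm : β m ≤ t := Nat.findGreatest_spec (P := fun n => β n ≤ t) (Nat.zero_le K) h0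
    have hiff : ∀ n, β n ≤ t ↔ n ≤ m := by
      refine fun n => ⟨fun h => ?_, fun h => (hβ h).trans hβm⟩
      refine Nat.le_findGreatest ?_ h
      by_contra hn
      exact absurd h (not_le.2 (hlt n (not_le.1 hn)))
    have hgr : IsGreatest {x | ∃ n, β n ≤ t ∧ x = genTime lam n} (genTime lam m) := by
      refine ⟨⟨m, hβm, rfl⟩, ?_⟩
      rintro x ⟨n, hn, rfl⟩
      have : (n : ℝ) ≤ m := by exact_mod_cast (hiff n).1 hn
      unfold genTime
      gcongr
    rw [hgr.csSup_eq]
    simp only [hiff]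
    rw [← Finset.sum_filter]
    have : (Finset.range K).filter (fun k => k + 1 ≤ m) = Finset.range m := by
      ext k
      simp only [Finset.mem_filter, Finset.mem_range]
      omega
    rw [this, Finset.sum_const, Finset.card_range, nsmul_eq_mul, genTime]
    ring
  -- Before the first reception `sSup ∅ = 0`, which agrees with the empty count. Update 0, generated
  -- at time 0, lowers nothing, so the count starts at update 1.
  · have hno : ∀ n, ¬ β n ≤ t := fun n h => h0 ((hβ (Nat.zero_le n)).trans h)
    simp [hno]

lemma integral_indicator_ge {b τ : ℝ} (hb : 0 ≤ b) (hτ : 0 ≤ τ) (c : ℝ) :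
    IntervalIntegrable (fun t => if b ≤ t then c else 0) volume 0 τ ∧
      ∫ t in (0 : ℝ)..τ, (if b ≤ t then c else 0) = c * max 0 (τ - b) := by
  have heq : (fun t => if b ≤ t then c else 0) = (Set.Ici b).indicator fun _ => c := by
    ext t
    simp [Set.indicator]
  rw [heq]
  refine ⟨?_, ?_⟩
  · exact (intervalIntegrable_const (c := c)).mono_fun
      (by fun_prop (disch := measurability))
      (Eventually.of_forall fun t => norm_indicator_le_norm_self _ _)
  · rw [intervalIntegral.integral_of_le hτ, setIntegral_indicator measurableSet_Ici,
      setIntegral_congr_set ((ae_eq_refl _).inter Ioi_ae_eq_Ici.symm), Set.Ioc_inter_Ioi,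
      max_eq_right hb, setIntegral_const, smul_eq_mul, mul_comm, Real.volume_real_Ioc, max_comm]

/-- With ordered receptions, each of the updates 1, 2, … lowers the age by `1 / lam` from its
reception onwards. Updates after `K` are generated after `τ` and cannot matter. -/
lemma integral_age {lam : ℝ} (hlam : 0 < lam) {β : ℕ → ℝ} (hβ : Monotone β)
    (hge : ∀ n, genTime lam n ≤ β n) {τ : ℝ} (hτ : 0 ≤ τ) {K : ℕ}
    (hK : τ < genTime lam (K + 1)) :
    ∫ t in (0 : ℝ)..τ, age (genTime lam) β t
      = τ ^ 2 / 2 - ∑ k ∈ Finset.range K, 1 / lam * max 0 (τ - β (k + 1)) := by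
  have hβ0 : ∀ n, 0 ≤ β n := fun n => le_trans (by unfold genTime; positivity) (hge n)
  have hcongr : ∫ t in (0 : ℝ)..τ, age (genTime lam) β t
      = ∫ t in (0 : ℝ)..τ,
        (t - ∑ k ∈ Finset.range K, if β (k + 1) ≤ t then 1 / lam else 0) := by
    refine intervalIntegral.integral_congr fun t ht => ?_
    rw [Set.uIcc_of_le hτ] at ht
    simp only [age]
    rw [sSup_received_eq_sum hlam hβ hge (ht.2.trans_lt hK)]
  have hint : ∀ k ∈ Finset.range K, IntervalIntegrable
      (fun t => if β (k + 1) ≤ t then 1 / lam else 0) volume 0 τ :=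
    fun k _ => (integral_indicator_ge (hβ0 _) hτ _).1
  rw [hcongr, intervalIntegral.integral_sub intervalIntegral.intervalIntegrable_id,
    intervalIntegral.integral_finsetSum hint, integral_id,
    Finset.sum_congr rfl fun k _ => (integral_indicator_ge (hβ0 (k + 1)) hτ (1 / lam)).2]
  · ring
  · simpa only [Finset.sum_fn] using IntervalIntegrable.sum _ hint

/-- Without the truncation at 0 the sum telescopes exactly, for every `N`; the square is the
triangle of age left over since generation `N`. -/
lemma sum_range_genTime (lam τ : ℝ) (d : ℕ → ℝ) (N : ℕ) :
    τ ^ 2 / 2 - ∑ k ∈ Finset.range N, 1 / lam * (τ - departure lam d (k + 1))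
      = (τ - genTime lam N) ^ 2 / 2
        + ∑ k ∈ Finset.range N, polygonArea (genInterval lam k) (d (k + 1)) := by
  induction N with
  | zero => simp [genTime]
  | succ N ih =>
    rw [Finset.sum_range_succ, Finset.sum_range_succ, ← sub_sub, ih, polygonArea_eq,
      genInterval_eq]
    simp only [departure, genTime]
    push_cast
    ring

/-- Dropping the truncation only increases the right side, and the leftover triangle has side at
most one generation interval. -/
lemma integral_age_le {lam : ℝ} (hlam : 0 < lam) {d : ℕ → ℝ} (hd : ∀ n, 0 ≤ d n)
    (hmono : Monotone (departure lam d)) {τ : ℝ} (hτ : 0 ≤ τ) :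
    ∫ t in (0 : ℝ)..τ, age (genTime lam) (departure lam d) t
      ≤ (1 / lam) ^ 2 / 2
        + ∑ k ∈ Finset.range ⌊lam * τ⌋₊, polygonArea (genInterval lam k) (d (k + 1)) := by
  have h1 : genTime lam ⌊lam * τ⌋₊ ≤ τ := by
    rw [genTime, div_le_iff₀ hlam, mul_comm τ]
    exact Nat.floor_le (by positivity)
  have h2 : τ < genTime lam (⌊lam * τ⌋₊ + 1) := by
    rw [genTime, lt_div_iff₀ hlam, mul_comm τ]
    push_cast
    exact Nat.lt_floor_add_one _
  rw [integral_age hlam hmono (fun n => by simpa [departure] using hd n) hτ h2]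
  calc _ ≤ τ ^ 2 / 2 - ∑ k ∈ Finset.range ⌊lam * τ⌋₊,
        1 / lam * (τ - departure lam d (k + 1)) := by
        gcongr
        exact le_max_right _ _
    _ ≤ _ := by
        rw [sum_range_genTime]
        have h3 : genTime lam (⌊lam * τ⌋₊ + 1) = genTime lam ⌊lam * τ⌋₊ + 1 / lam := by
          have := genInterval_eq lam ⌊lam * τ⌋₊
          rw [genInterval] at this
          linarith
        have h4 : 0 ≤ τ - genTime lam ⌊lam * τ⌋₊ := by linarith
        have h5 : τ - genTime lam ⌊lam * τ⌋₊ ≤ 1 / lam := by linarith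
        gcongr

/-- Cutting at the last update received by `τ` makes the truncation exact: it is inactive up to `N`
and gives 0 beyond. The leftover square is discarded. -/
lemma exists_le_integral_age {lam : ℝ} (hlam : 0 < lam) {d : ℕ → ℝ} (hd : ∀ n, 0 ≤ d n)
    (hmono : Monotone (departure lam d)) {τ : ℝ} (hτ : 0 ≤ τ) :
    ∃ N : ℕ, genTime lam N ≤ τ ∧ τ < departure lam d (N + 1) ∧
      ∑ k ∈ Finset.range N, polygonArea (genInterval lam k) (d (k + 1))
        ≤ ∫ t in (0 : ℝ)..τ, age (genTime lam) (departure lam d) t := by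
  classical
  have hge : ∀ n, genTime lam n ≤ departure lam d n := fun n => by simpa [departure] using hd n
  have h1 : genTime lam ⌊lam * τ⌋₊ ≤ τ := by
    rw [genTime, div_le_iff₀ hlam, mul_comm τ]
    exact Nat.floor_le (by positivity)
  have h2 : τ < genTime lam (⌊lam * τ⌋₊ + 1) := by
    rw [genTime, lt_div_iff₀ hlam, mul_comm τ]
    push_cast
    exact Nat.lt_floor_add_one _
  set K := ⌊lam * τ⌋₊ with hKdef
  -- If nothing has been received by `τ`, the default value 0 still serves: the sum is then empty.
  set N := Nat.findGreatest (fun n => departure lam d n ≤ τ) K with hN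
  have hNK : N ≤ K := Nat.findGreatest_le K
  have hlt : τ < departure lam d (N + 1) := by
    rcases hNK.eq_or_lt with h | h
    · rw [h]
      exact h2.trans_le (hge _)
    · exact not_le.1 (Nat.findGreatest_is_greatest (Nat.lt_succ_self N) h)
  refine ⟨N, le_trans ?_ h1, hlt, ?_⟩
  · unfold genTime
    gcongr
  have hsum : ∑ k ∈ Finset.range K, 1 / lam * max 0 (τ - departure lam d (k + 1))
      = ∑ k ∈ Finset.range N, 1 / lam * (τ - departure lam d (k + 1)) := by
    rw [← Finset.sum_subset (Finset.range_mono hNK)]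
    · refine Finset.sum_congr rfl fun k hk => ?_
      rw [max_eq_right]
      have hkN : k + 1 ≤ N := Finset.mem_range.1 hk
      have hNτ : departure lam d N ≤ τ :=
        Nat.findGreatest_of_ne_zero (P := fun n => departure lam d n ≤ τ) hN.symm (by omega)
      linarith [hmono hkN]
    · intro k _ hk
      have hNk : N + 1 ≤ k + 1 := by
        have := Finset.mem_range.not.1 hk
        omega
      rw [max_eq_left, mul_zero]
      linarith [hmono hNk]
  rw [integral_age hlam hmono hge hτ h2, hsum, sum_range_genTime]
  exact le_add_of_nonneg_left (by positivity)

/-- For the empirical means Mₙ, one has uₙ/n = (1 + 1/n) Mₙ₊₁ - Mₙ. -/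
lemma tendsto_div_of_tendsto_mean {u : ℕ → ℝ} {q : ℝ}
    (hu : Tendsto (fun N : ℕ => (1 / (N : ℝ)) * ∑ n ∈ Finset.range N, u n) atTop (𝓝 q)) :
    Tendsto (fun n : ℕ => u n / n) atTop (𝓝 0) := by
  have h1 := hu.comp (tendsto_add_atTop_nat 1)
  have h2 : Tendsto (fun n : ℕ => 1 + 1 / (n : ℝ)) atTop (𝓝 (1 + 0)) :=
    tendsto_const_nhds.add tendsto_one_div_atTop_nhds_zero_nat
  have h3 := (h2.mul h1).sub hu
  rw [add_zero, one_mul, sub_self] at h3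
  refine h3.congr' ?_
  filter_upwards [eventually_gt_atTop 0] with n hn
  have hn' : (n : ℝ) ≠ 0 := by positivity
  have hn1 : (n : ℝ) + 1 ≠ 0 := by positivity
  simp only [Function.comp, Finset.sum_range_succ]
  push_cast
  field_simp
  ring

/-- The time average of the age, along a path whose areas have an asymptotic mean. -/
lemma tendsto_timeAverageAge {lam : ℝ} (hlam : 0 < lam) {d : ℕ → ℝ} (hd : ∀ n, 0 ≤ d n)
    (hmono : Monotone (departure lam d)) {q : ℝ}
    (hq : Tendsto (fun N : ℕ =>
      (1 / (N : ℝ)) * ∑ n ∈ Finset.range N, polygonArea (genInterval lam n) (d (n + 1)))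
      atTop (𝓝 q)) :
    Tendsto (timeAverageAge lam d) atTop (𝓝 (q * lam)) := by
  set Q : ℕ → ℝ := fun n => polygonArea (genInterval lam n) (d (n + 1)) with hQ
  have hmean : ∀ {N : ℝ → ℕ}, Tendsto N atTop atTop →
      Tendsto (fun τ : ℝ => (N τ : ℝ) / τ) atTop (𝓝 lam) →
      Tendsto (fun τ : ℝ => (∑ n ∈ Finset.range (N τ), Q n) / τ) atTop (𝓝 (q * lam)) := by
    intro N hN hNτ
    refine ((hq.comp hN).mul hNτ).congr' ?_
    filter_upwards [hN.eventually_gt_atTop 0] with τ hτ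
    have : (N τ : ℝ) ≠ 0 := by positivity
    simp only [Function.comp]
    field_simp
  -- Convergence of the mean area makes the delays sublinear, so departures occur at the generation
  -- rate.
  have hd0 : Tendsto (fun n : ℕ => d (n + 1) / n) atTop (𝓝 0) := by
    have h1 := (tendsto_div_of_tendsto_mean hq).const_mul lam
    have h2 : Tendsto (fun n : ℕ => (1 / lam) / 2 * (1 / (n : ℝ))) atTop
        (𝓝 ((1 / lam) / 2 * 0)) := tendsto_one_div_atTop_nhds_zero_nat.const_mul _
    have h3 := h1.sub h2
    rw [mul_zero, mul_zero, sub_zero] at h3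
    refine h3.congr fun n => ?_
    rw [polygonArea_eq, genInterval_eq]
    field_simp
    ring
  have hdep : Tendsto (fun n : ℕ => (n : ℝ) / departure lam d (n + 1)) atTop (𝓝 lam) := by
    have h1 : Tendsto (fun n : ℕ => 1 / lam * (1 + 1 / (n : ℝ)) + d (n + 1) / n) atTop
        (𝓝 (1 / lam * (1 + 0) + 0)) :=
      ((tendsto_const_nhds.add tendsto_one_div_atTop_nhds_zero_nat).const_mul _).add hd0
    have h2 := h1.inv₀ (by positivity)
    rw [add_zero, add_zero, mul_one, one_div, inv_inv] at h2
    refine h2.congr' ?_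
    filter_upwards [eventually_gt_atTop 0] with n hn
    have hn' : (n : ℝ) ≠ 0 := by positivity
    rw [← inv_div]
    simp only [departure, genTime]
    push_cast
    field_simp
  have hN : ∀ τ : ℝ, ∃ N : ℕ, 0 ≤ τ → genTime lam N ≤ τ ∧ τ < departure lam d (N + 1) ∧
      ∑ k ∈ Finset.range N, Q k
        ≤ ∫ t in (0 : ℝ)..τ, age (genTime lam) (departure lam d) t := fun τ => by
    by_cases hτ : 0 ≤ τ
    · obtain ⟨N, hN⟩ := exists_le_integral_age hlam hd hmono hτ
      exact ⟨N, fun _ => hN⟩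
    · exact ⟨0, fun h => absurd h hτ⟩
  choose N hN using hN
  have hNtop : Tendsto N atTop atTop := by
    rw [tendsto_atTop]
    intro m
    filter_upwards [eventually_ge_atTop (departure lam d m), eventually_ge_atTop 0] with τ h1 h0
    by_contra hlt
    have hle : N τ + 1 ≤ m := by omega
    linarith [hmono hle, (hN τ h0).2.1]
  have hNdiv : Tendsto (fun τ : ℝ => (N τ : ℝ) / τ) atTop (𝓝 lam) := by
    refine tendsto_of_tendsto_of_tendsto_of_le_of_le' (hdep.comp hNtop) tendsto_const_nhds ?_ ?_
    · filter_upwards [eventually_gt_atTop 0] with τ hτ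
      have := (hN τ hτ.le).2.1
      simp only [Function.comp]
      gcongr
    · filter_upwards [eventually_gt_atTop 0] with τ hτ
      have := (hN τ hτ.le).1
      rw [genTime, div_le_iff₀ hlam] at this
      rw [div_le_iff₀ hτ]
      linarith
  have hfloor : Tendsto (fun τ : ℝ => ⌊lam * τ⌋₊) atTop atTop :=
    tendsto_nat_floor_atTop.comp (tendsto_id.const_mul_atTop hlam)
  have hupper := (hmean hfloor (tendsto_nat_floor_mul_div_atTop hlam.le)).add
    ((tendsto_inv_atTop_zero (𝕜 := ℝ)).const_mul ((1 / lam) ^ 2 / 2))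
  rw [mul_zero, add_zero] at hupper
  refine tendsto_of_tendsto_of_tendsto_of_le_of_le' (hmean hNtop hNdiv) hupper ?_ ?_
  · filter_upwards [eventually_gt_atTop 0] with τ hτ
    rw [timeAverageAge, div_eq_inv_mul, one_div]
    gcongr
    exact (hN τ hτ.le).2.2
  · filter_upwards [eventually_gt_atTop 0] with τ hτ
    rw [timeAverageAge, one_div, mul_comm, div_eq_mul_inv, ← add_mul]
    gcongr
    rw [add_comm]
    exact integral_age_le hlam hd hmono hτ.le


/-! ### The exponential law and the candidate tail of the waiting time. -/

lemma integral_expMeasure {r : ℝ} (hr : 0 < r) (f : ℝ → ℝ) :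
    ∫ y, f y ∂(expMeasure r) = ∫ y in Set.Ioi 0, r * Real.exp (-(r * y)) * f y := by
  have hdens : expMeasure r = volume.withDensity (exponentialPDF r) := rfl
  have hm : Measurable (exponentialPDF r) :=
    (measurable_exponentialPDFReal r).ennreal_ofReal
  rw [hdens, integral_withDensity_eq_integral_toReal_smul hm
    (Eventually.of_forall fun _ => ENNReal.ofReal_lt_top), ← integral_Ici_eq_integral_Ioi,
    ← integral_indicator measurableSet_Ici]
  congr 1 with y
  rw [exponentialPDF_eq, smul_eq_mul, Set.indicator_apply]
  by_cases hy : 0 ≤ y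
  · rw [if_pos hy, if_pos (Set.mem_Ici.2 hy), ENNReal.toReal_ofReal (by positivity)]
  · rw [if_neg hy, if_neg (by simpa using hy)]
    simp

lemma expMeasure_real_Ioi {r : ℝ} (hr : 0 < r) {x : ℝ} (hx : 0 ≤ x) :
    (expMeasure r).real (Set.Ioi x) = Real.exp (-(r * x)) := by
  have := isProbabilityMeasure_expMeasure hr
  rw [← Set.compl_Iic, probReal_compl_eq_one_sub measurableSet_Iic, ← cdf_eq_real,
    cdf_expMeasure_eq hr, if_pos hx]
  ring

lemma ae_nonneg_expMeasure {r : ℝ} (hr : 0 < r) : ∀ᵐ y ∂(expMeasure r), 0 ≤ y := by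
  have := isProbabilityMeasure_expMeasure hr
  have h : (expMeasure r).real (Set.Ioi 0)ᶜ = 0 := by
    rw [probReal_compl_eq_one_sub measurableSet_Ioi, expMeasure_real_Ioi hr le_rfl]
    simp
  rw [measureReal_eq_zero_iff] at h
  exact measure_mono_null (fun y hy => by simpa using le_of_lt (by simpa using hy)) h

/-- The tail of a distribution with an atom of mass `1 - η` at `0` and an exponential remainder:
the stationary waiting time of a G/M/1 queue. -/
noncomputable def waitingTail (μ η x : ℝ) : ℝ :=
  if x < 0 then 1 else η * Real.exp (-(μ * (1 - η) * x))

lemma measurable_waitingTail (μ η : ℝ) : Measurable (waitingTail μ η) :=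
  Measurable.ite measurableSet_Iio (by fun_prop) (by fun_prop)

lemma waitingTail_nonneg {μ η : ℝ} (h0 : 0 ≤ η) (x : ℝ) : 0 ≤ waitingTail μ η x := by
  unfold waitingTail
  split_ifs
  exacts [zero_le_one, mul_nonneg h0 (Real.exp_pos _).le]

lemma waitingTail_le_one {μ η : ℝ} (hμ : 0 < μ) (h1 : η < 1) (x : ℝ) :
    waitingTail μ η x ≤ 1 := by
  unfold waitingTail
  split_ifs with hx
  · exact le_rfl
  · have : 0 ≤ μ * (1 - η) * x := mul_nonneg (mul_nonneg hμ.le (by linarith)) (not_lt.1 hx)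
    exact mul_le_one₀ h1.le (Real.exp_pos _).le (Real.exp_le_one_iff.2 (by linarith))

lemma tendsto_waitingTail {μ η : ℝ} (hμ : 0 < μ) (h1 : η < 1) :
    Tendsto (waitingTail μ η) atTop (𝓝 0) := by
  have hk : 0 < μ * (1 - η) := mul_pos hμ (by linarith)
  have h := (Real.tendsto_exp_neg_atTop_nhds_zero.comp (tendsto_id.const_mul_atTop hk)).const_mul η
  rw [mul_zero] at h
  refine h.congr' ?_
  filter_upwards [eventually_ge_atTop 0] with x hx
  simp [waitingTail, not_lt.2 hx]

/-- Adding an independent exponential service time to the waiting time gives an exponential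
sojourn time. -/
lemma integral_waitingTail_sub {μ η : ℝ} (hμ : 0 < μ) (h0 : 0 < η) {u : ℝ} (hu : 0 ≤ u) :
    ∫ y, waitingTail μ η (u - y) ∂(expMeasure μ) = Real.exp (-(μ * (1 - η) * u)) := by
  have hμη : 0 < μ * η := by positivity
  -- The integral splits at `u`: a service time beyond `u` exceeds it alone, a shorter one leaves
  -- the exponential part of the tail.
  have hfst : ∀ y ∈ Set.Ioc 0 u, μ * Real.exp (-(μ * y)) * waitingTail μ η (u - y)
      = Real.exp (-(μ * (1 - η) * u)) * (μ * η * Real.exp (-(μ * η * y))) := by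
    intro y hy
    rw [waitingTail, if_neg (by linarith [hy.2])]
    have : Real.exp (-(μ * y)) * Real.exp (-(μ * (1 - η) * (u - y)))
        = Real.exp (-(μ * (1 - η) * u)) * Real.exp (-(μ * η * y)) := by
      rw [← Real.exp_add, ← Real.exp_add]
      ring_nf
    linear_combination μ * η * this
  have hsnd : ∀ y ∈ Set.Ioi u, μ * Real.exp (-(μ * y)) * waitingTail μ η (u - y)
      = μ * Real.exp (-μ * y) := by
    intro y hy
    rw [waitingTail, if_pos (by linarith [Set.mem_Ioi.1 hy]), mul_one, neg_mul]
  have hi1 : IntegrableOn (fun y => Real.exp (-(μ * (1 - η) * u)) *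
      (μ * η * Real.exp (-(μ * η * y)))) (Set.Ioc 0 u) :=
    ((Continuous.integrableOn_Ioc (by fun_prop)))
  have hi2 : IntegrableOn (fun y => μ * Real.exp (-μ * y)) (Set.Ioi u) :=
    (integrableOn_exp_mul_Ioi (by linarith) u).const_mul μ
  have hint : ∫ y in Set.Ioc 0 u, μ * η * Real.exp (-(μ * η * y))
      = 1 - Real.exp (-(μ * η * u)) := by
    rw [← intervalIntegral.integral_of_le hu, intervalIntegral.integral_eq_sub_of_hasDerivAt
      (fun y _ => hasDerivAt_neg_exp_mul_exp) (Continuous.intervalIntegrable (by fun_prop) _ _)]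
    simp
    ring
  rw [integral_expMeasure hμ, ← Set.Ioc_union_Ioi_eq_Ioi hu,
    setIntegral_union (Set.Ioc_disjoint_Ioi le_rfl) measurableSet_Ioi
      (hi1.congr_fun (fun y hy => (hfst y hy).symm) measurableSet_Ioc)
      (hi2.congr_fun (fun y hy => (hsnd y hy).symm) measurableSet_Ioi),
    setIntegral_congr_fun measurableSet_Ioc hfst, setIntegral_congr_fun measurableSet_Ioi hsnd,
    integral_const_mul (Real.exp (-(μ * (1 - η) * u))), hint, integral_const_mul,
    integral_exp_mul_Ioi (by linarith)]
  have : Real.exp (-(μ * (1 - η) * u)) * Real.exp (-(μ * η * u)) = Real.exp (-(μ * u)) := by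
    rw [← Real.exp_add]
    ring_nf
  field_simp
  linear_combination -this

/-! ### Random walks with drift, and means from exponential tails. -/

section Walk

variable {Ω : Type*} [MeasurableSpace Ω] {P : Measure Ω} [IsProbabilityMeasure P]

/-- A bounded function that vanishes at infinity and is subharmonic for a random walk with
positive drift is nonpositive. -/
lemma le_zero_of_le_integral_walk {X : ℕ → Ω → ℝ} (hX : ∀ n, Measurable (X n))
    (hindep : iIndepFun X P) (hident : ∀ n, P.map (X n) = P.map (X 0))
    (hint : Integrable (X 0) P) (hneg : ∫ ω, X 0 ω ∂P < 0)
    {h : ℝ → ℝ} (hm : Measurable h) (hb : ∀ x, |h x| ≤ 1) (hlim : Tendsto h atTop (𝓝 0))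
    (hsub : ∀ x, h x ≤ ∫ ω, h (x - X 0 ω) ∂P) (x : ℝ) : h x ≤ 0 := by
  have hSm : ∀ n, Measurable (fun ω => ∑ i ∈ Finset.range n, X i ω) := fun n =>
    Finset.measurable_fun_sum _ fun i _ => hX i
  -- Subharmonicity is iterated by conditioning on the first `n` steps, which are independent of
  -- step `n`.
  have hiter : ∀ n, h x ≤ ∫ ω, h (x - ∑ i ∈ Finset.range n, X i ω) ∂P := by
    intro n
    induction n with
    | zero => simp
    | succ n ih =>
      refine ih.trans ?_
      set T : Ω → ℝ := fun ω => ∑ i ∈ Finset.range n, X i ω with hT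
      have hind : IndepFun T (X n) P := by
        have := hindep.indepFun_sum_range_succ hX n
        have hTe : T = ∑ j ∈ Finset.range n, X j := by
          ext ω
          simp [hT]
        rwa [hTe]
      have hprod := (indepFun_iff_map_prod_eq_prod_map_map (hSm n).aemeasurable
        (hX n).aemeasurable).1 hind
      have := Measure.isProbabilityMeasure_map (μ := P) (hSm n).aemeasurable
      have := Measure.isProbabilityMeasure_map (μ := P) (hX n).aemeasurable
      have hbd : ∀ ν : Measure ℝ, IsProbabilityMeasure ν → ∀ f : ℝ → ℝ, Measurable f →
          Integrable (fun y => h (f y)) ν := fun ν _ f hf =>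
        Integrable.of_bound (hm.comp hf).aestronglyMeasurable 1 (Eventually.of_forall fun y => hb _)
      calc ∫ ω, h (x - T ω) ∂P = ∫ s, h (x - s) ∂(P.map T) :=
            (integral_map (hSm n).aemeasurable
              (hm.comp (measurable_const.sub measurable_id)).aestronglyMeasurable).symm
        _ ≤ ∫ s, ∫ u, h (x - s - u) ∂(P.map (X n)) ∂(P.map T) := by
            have hm2 : Measurable (fun p : ℝ × ℝ => h (x - p.1 - p.2)) := by fun_prop
            refine integral_mono (hbd _ inferInstance _ (by fun_prop)) ?_ fun s => ?_
            · refine Integrable.of_bound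
                hm2.stronglyMeasurable.integral_prod_right.aestronglyMeasurable 1
                (Eventually.of_forall fun s => ?_)
              refine (norm_integral_le_of_norm_le_const (C := 1)
                (Eventually.of_forall fun u => hb _)).trans ?_
              simp
            · simp only
              rw [hident n, integral_map (hX 0).aemeasurable
                (Measurable.aestronglyMeasurable (by fun_prop))]
              exact hsub _
        _ = ∫ p, h (x - p.1 - p.2) ∂((P.map T).prod (P.map (X n))) := by
            refine (integral_prod (f := fun p : ℝ × ℝ => h (x - p.1 - p.2)) ?_).symm
            exact Integrable.of_bound (Measurable.aestronglyMeasurable (by fun_prop)) 1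
              (Eventually.of_forall fun p => hb _)
        _ = ∫ ω, h (x - ∑ i ∈ Finset.range (n + 1), X i ω) ∂P := by
            rw [← hprod, integral_map ((hSm n).prodMk (hX n)).aemeasurable
              (Measurable.aestronglyMeasurable (by fun_prop))]
            simp only [Finset.sum_range_succ, sub_sub]
  have hslln := strong_law_ae_real X hint
    (fun i j hij => hindep.indepFun hij)
    (fun i => ⟨(hX i).aemeasurable, (hX 0).aemeasurable, hident i⟩)
  have hto : Tendsto (fun n : ℕ => ∫ ω, h (x - ∑ i ∈ Finset.range n, X i ω) ∂P) atTop
      (𝓝 (∫ _, (0 : ℝ) ∂P)) := by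
    refine tendsto_integral_of_dominated_convergence (fun _ => 1)
      (fun n => (hm.comp (measurable_const.sub (hSm n))).aestronglyMeasurable)
      (integrable_const 1) (fun n => Eventually.of_forall fun ω => hb _) ?_
    filter_upwards [hslln] with ω hω
    refine hlim.comp ?_
    have h1 : Tendsto (fun n : ℕ => ∑ i ∈ Finset.range n, X i ω) atTop atBot := by
      have h2 := (tendsto_natCast_atTop_atTop (R := ℝ)).atTop_mul_neg hneg hω
      refine h2.congr' ?_
      filter_upwards [eventually_gt_atTop 0] with n hn
      have : (n : ℝ) ≠ 0 := by positivity
      field_simp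
    exact tendsto_atTop_add_const_left _ x (tendsto_neg_atBot_atTop.comp h1)
  rw [integral_zero] at hto
  exact ge_of_tendsto' hto hiter

/-- Mean of a nonnegative random variable with an exponential tail. -/
lemma integrable_and_integral_of_tail {Y : Ω → ℝ} (hY : Measurable Y) (h0 : 0 ≤ᵐ[P] Y)
    {c k : ℝ} (hc : 0 ≤ c) (hk : 0 < k)
    (htail : ∀ x, 0 ≤ x → P.real {ω | x < Y ω} = c * Real.exp (-(k * x))) :
    Integrable Y P ∧ ∫ ω, Y ω ∂P = c / k := by
  -- The layer-cake formula in `ENNReal` yields integrability and the mean together.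
  have hl : ∫⁻ ω, ENNReal.ofReal (Y ω) ∂P = ENNReal.ofReal (c / k) := by
    rw [lintegral_eq_lintegral_meas_lt P h0 hY.aemeasurable,
      setLIntegral_congr_fun (g := fun t => ENNReal.ofReal (c * Real.exp (-k * t)))
        measurableSet_Ioi, ← ofReal_integral_eq_lintegral_ofReal, integral_const_mul,
      integral_exp_mul_Ioi (by linarith)]
    · congr 1
      simp
      ring
    · exact (integrableOn_exp_mul_Ioi (by linarith) 0).const_mul c
    · exact Eventually.of_forall fun t => by positivity
    · intro t ht
      simp only
      rw [neg_mul, ← htail t (le_of_lt ht), ofReal_measureReal]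
  refine ⟨⟨hY.aestronglyMeasurable, ?_⟩, ?_⟩
  · rw [hasFiniteIntegral_iff_ofReal h0, hl]
    exact ENNReal.ofReal_lt_top
  · rw [integral_eq_lintegral_of_nonneg_ae h0 hY.aestronglyMeasurable, hl,
      ENNReal.toReal_ofReal (by positivity)]

end Walk


/-! ### Existence and positivity of the roots. -/

section Roots

variable {G : Measure ℝ} [IsProbabilityMeasure G]

lemma integrable_exp_neg_mul (hG : ∀ᵐ x ∂G, 0 ≤ x) {s : ℝ} (hs : 0 ≤ s) :
    Integrable (fun x => Real.exp (-(s * x))) G := by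
  refine Integrable.of_bound (by fun_prop) 1 ?_
  filter_upwards [hG] with x hx
  rw [Real.norm_eq_abs, Real.abs_exp, Real.exp_le_one_iff]
  nlinarith [mul_nonneg hs hx]

lemma laplace_pos (hG : ∀ᵐ x ∂G, 0 ≤ x) {s : ℝ} (hs : 0 ≤ s) : 0 < laplace G s :=
  integral_exp_pos (integrable_exp_neg_mul hG hs)

lemma continuousOn_laplace (hG : ∀ᵐ x ∂G, 0 ≤ x) : ContinuousOn (laplace G) (Set.Ici 0) := by
  refine continuousOn_of_dominated (bound := fun _ => 1) (fun s _ => by fun_prop)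
    (fun s hs => ?_) (integrable_const 1) (Eventually.of_forall fun x => by fun_prop)
  filter_upwards [hG] with x hx
  rw [Real.norm_eq_abs, Real.abs_exp, Real.exp_le_one_iff]
  nlinarith [mul_nonneg (Set.mem_Ici.1 hs) hx]

/-- Intermediate values on `[0, c]`: the transform is positive at the left end and at most `c` at
the right end. -/
lemma exists_root_le (hG : ∀ᵐ x ∂G, 0 ≤ x) {μ : ℝ} (hμ : 0 < μ) {c : ℝ} (h0 : 0 ≤ c)
    (h1 : c < 1) (hc : laplace G (μ * (1 - c)) ≤ c) :
    ∃ η ∈ rootSet G μ, 0 < η ∧ η ≤ c := by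
  have hcont : ContinuousOn (fun x => x - laplace G (μ * (1 - x))) (Set.Icc 0 c) := by
    refine continuousOn_id.sub ((continuousOn_laplace hG).comp (by fun_prop) fun x hx => ?_)
    exact mul_nonneg hμ.le (by linarith [hx.2])
  have hpos : 0 < laplace G (μ * (1 - 0)) := laplace_pos hG (by linarith)
  obtain ⟨η, hη, hz⟩ := intermediate_value_Icc h0 hcont
    (show (0 : ℝ) ∈ Set.Icc _ _ from ⟨by linarith, by linarith⟩)
  have hroot : η = laplace G (μ * (1 - η)) := by simpa [sub_eq_zero] using hz
  refine ⟨η, hroot, ?_, hη.2⟩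
  rw [hroot]
  exact laplace_pos hG (mul_nonneg hμ.le (by linarith [hη.2]))

/-- This is the derivative of the transform at 0, by dominated convergence from 0 ≤ 1 - exp(-sx) ≤
sx. -/
lemma tendsto_one_sub_laplace_div (hG : ∀ᵐ x ∂G, 0 ≤ x) (hint : Integrable (fun x => x) G) :
    Tendsto (fun s => (1 - laplace G s) / s) (𝓝[>] 0) (𝓝 (∫ x, x ∂G)) := by
  have h : Tendsto (fun s => ∫ x, (1 - Real.exp (-(s * x))) / s ∂G) (𝓝[>] 0)
      (𝓝 (∫ x, x ∂G)) := by
    refine tendsto_integral_filter_of_dominated_convergence (fun x => x)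
      (Eventually.of_forall fun s => by fun_prop) ?_ hint ?_
    · filter_upwards [self_mem_nhdsWithin] with s hs
      have hs : 0 < s := hs
      filter_upwards [hG] with x hx
      have h1 : Real.exp (-(s * x)) ≤ 1 :=
        Real.exp_le_one_iff.2 (by nlinarith [mul_nonneg hs.le hx])
      have h2 := Real.add_one_le_exp (-(s * x))
      rw [Real.norm_of_nonneg (div_nonneg (by linarith) hs.le), div_le_iff₀ hs]
      linarith
    · refine Eventually.of_forall fun x => ?_
      have hd : HasDerivAt (fun s : ℝ => 1 - Real.exp (-(s * x))) x 0 := by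
        have := (((hasDerivAt_id (0 : ℝ)).mul_const x).neg.exp).const_sub 1
        simpa using this
      have := (hasDerivAt_iff_tendsto_slope_zero.1 hd).mono_left
        (nhdsWithin_mono 0 (fun y (hy : 0 < y) => hy.ne'))
      refine this.congr fun s => ?_
      simp
      ring
  refine h.congr' ?_
  filter_upwards [self_mem_nhdsWithin] with s hs
  rw [integral_div, integral_sub (integrable_const 1)
    (integrable_exp_neg_mul hG (le_of_lt hs))]
  simp [laplace]

/-- Since the mean exceeds 1/μ, a small s > 0 has L(s) < 1 - s/μ, so c = 1 - s/μ lies above its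
transform value. -/
lemma exists_root (hG : ∀ᵐ x ∂G, 0 ≤ x) (hint : Integrable (fun x => x) G) {μ : ℝ} (hμ : 0 < μ)
    (hmean : 1 / μ < ∫ x, x ∂G) : ∃ η ∈ rootSet G μ, 0 < η ∧ η < 1 := by
  have h1 := (tendsto_one_sub_laplace_div hG hint).eventually (lt_mem_nhds hmean)
  have h2 : ∀ᶠ s in 𝓝[>] (0 : ℝ), s < μ := nhdsWithin_le_nhds (gt_mem_nhds hμ)
  obtain ⟨s, ⟨hs1, hs2⟩, hs : 0 < s⟩ := ((h1.and h2).and self_mem_nhdsWithin).exists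
  rw [lt_div_iff₀ hs] at hs1
  have hsμ : s / μ < 1 := (div_lt_one hμ).2 hs2
  have hsμ0 : 0 < s / μ := by positivity
  obtain ⟨η, hη, h0, hle⟩ := exists_root_le hG hμ (c := 1 - s / μ) (by linarith) (by linarith) (by
    rw [sub_sub_cancel, mul_div_cancel₀ _ hμ.ne']
    have : 1 / μ * s = s / μ := by ring
    linarith)
  exact ⟨η, hη, h0, by linarith⟩

lemma pos_of_mem_rootSet (hG : ∀ᵐ x ∂G, 0 ≤ x) {μ : ℝ} (hμ : 0 < μ) {x : ℝ}
    (hx : x ∈ rootSet G μ) : 0 < x := by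
  have hx : x = laplace G (μ * (1 - x)) := hx
  by_contra hn
  have := laplace_pos hG (s := μ * (1 - x)) (mul_nonneg hμ.le (by linarith))
  linarith

end Roots

/-! ### The stationary G/M/1 queue. -/

namespace IsSteadyGM1

variable {Ω : Type*} [MeasurableSpace Ω] {P : Measure Ω}
  {G : Measure ℝ} {μ : ℝ} {A H W : ℕ → Ω → ℝ}

lemma W_nonneg (h : IsSteadyGM1 P G μ A H W) (n : ℕ) (ω : Ω) : 0 ≤ W n ω := by
  cases n with
  | zero => exact h.initial_nonneg ω
  | succ n =>
    rw [h.lindley]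
    exact le_max_left _ _

lemma H_nonneg (h : IsSteadyGM1 P G μ A H W) (hμ : 0 < μ) (n : ℕ) : 0 ≤ᵐ[P] H n := by
  have := ae_nonneg_expMeasure hμ
  rw [← h.law_H n] at this
  exact ae_of_ae_map (h.measurable_H n).aemeasurable this

variable [IsProbabilityMeasure P]

lemma integrable_H (h : IsSteadyGM1 P G μ A H W) (hμ : 0 < μ) (n : ℕ) :
    Integrable (H n) P ∧ ∫ ω, H n ω ∂P = 1 / μ := by
  refine integrable_and_integral_of_tail (h.measurable_H n) (h.H_nonneg hμ n) zero_le_one hμ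
    fun x hx => ?_
  rw [one_mul, ← expMeasure_real_Ioi hμ hx, ← h.law_H n,
    map_measureReal_apply (h.measurable_H n) measurableSet_Ioi]
  rfl

lemma integral_step (h : IsSteadyGM1 P G μ A H W) {f : ℝ → ℝ} (hf : Measurable f)
    (hb : ∀ x, |f x| ≤ 1) (x : ℝ) :
    ∫ ω, f (x - (H 0 ω - A 0 ω)) ∂P = ∫ a, ∫ y, f (x + a - y) ∂(expMeasure μ) ∂G := by
  have hprod := (indepFun_iff_map_prod_eq_prod_map_map (h.measurable_A 0).aemeasurable
    (h.measurable_H 0).aemeasurable).1 (h.indep_A_H 0)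
  have i1 := Measure.isProbabilityMeasure_map (μ := P) (h.measurable_A 0).aemeasurable
  have i2 := Measure.isProbabilityMeasure_map (μ := P) (h.measurable_H 0).aemeasurable
  rw [h.law_A] at i1 hprod
  rw [h.law_H] at i2 hprod
  have hint : Integrable (fun p : ℝ × ℝ => f (x + p.1 - p.2)) (G.prod (expMeasure μ)) :=
    Integrable.of_bound (Measurable.aestronglyMeasurable (by fun_prop)) 1
      (Eventually.of_forall fun p => hb _)
  rw [← integral_prod (f := fun p : ℝ × ℝ => f (x + p.1 - p.2)) hint, ← hprod,
    integral_map ((h.measurable_A 0).prodMk (h.measurable_H 0)).aemeasurable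
      (Measurable.aestronglyMeasurable (by fun_prop))]
  congr 1 with ω
  congr 1
  ring

/-- Given an inter-arrival time a, the service time turns the tail into exp(-μ(1-η)(x+a)); averaging
over a produces L(μ(1-η)), which the root equation identifies with η. -/
lemma integral_waitingTail (h : IsSteadyGM1 P G μ A H W) [IsProbabilityMeasure G]
    (hG : ∀ᵐ x ∂G, 0 ≤ x) (hμ : 0 < μ) {η : ℝ} (hη : η ∈ rootSet G μ) (h1 : η < 1) {x : ℝ}
    (hx : 0 ≤ x) :
    ∫ ω, waitingTail μ η (x - (H 0 ω - A 0 ω)) ∂P = waitingTail μ η x := by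
  have h0 := pos_of_mem_rootSet hG hμ hη
  rw [h.integral_step (measurable_waitingTail μ η) fun x => by
    rw [abs_of_nonneg (waitingTail_nonneg h0.le x)]
    exact waitingTail_le_one hμ h1 x]
  have hη' : η = laplace G (μ * (1 - η)) := hη
  rw [waitingTail, if_neg (not_lt.2 hx)]
  refine Eq.trans ?_ (congrArg (· * Real.exp (-(μ * (1 - η) * x))) hη'.symm)
  rw [laplace, ← integral_mul_const]
  refine integral_congr_ae ?_
  filter_upwards [hG] with a ha
  rw [integral_waitingTail_sub hμ h0 (by linarith), ← Real.exp_add]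
  ring_nf

/-- The stationarity equation for the tail of the waiting time. -/
lemma measureReal_lt_W (h : IsSteadyGM1 P G μ A H W) {x : ℝ} (hx : 0 ≤ x) :
    P.real {ω | x < W 0 ω} = ∫ ω, P.real {ω' | x - (H 0 ω - A 0 ω) < W 0 ω'} ∂P := by
  have hX : Measurable fun ω => H 0 ω - A 0 ω := (h.measurable_H 0).sub (h.measurable_A 0)
  have hind : IndepFun (fun ω => H 0 ω - A 0 ω) (W 0) P := by
    have := h.indep_initial.symm.comp (φ := fun p : ℕ → ℝ × ℝ => (p 0).2 - (p 0).1) (ψ := id)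
      (by fun_prop) measurable_id
    exact this
  have hprod := (indepFun_iff_map_prod_eq_prod_map_map hX.aemeasurable
    (h.measurable_W 0).aemeasurable).1 hind
  have i1 := Measure.isProbabilityMeasure_map (μ := P) hX.aemeasurable
  have i2 := Measure.isProbabilityMeasure_map (μ := P) (h.measurable_W 0).aemeasurable
  have hset : MeasurableSet {p : ℝ × ℝ | x < p.1 + p.2} :=
    measurableSet_lt measurable_const (by fun_prop)
  have hmeas : Measurable fun u => P.map (W 0) (Set.Ioi (x - u)) := by
    refine Monotone.measurable fun u v huv => ?_
    exact measure_mono (Set.Ioi_subset_Ioi (by linarith))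
  have hstep : P {ω | x < W 0 ω} = ∫⁻ ω, P {ω' | x - (H 0 ω - A 0 ω) < W 0 ω'} ∂P := by
    -- Stationarity replaces `W 0` by `W 1`; as `x ≥ 0`, the reflection at 0 in the Lindley
    -- recursion is invisible.
    calc P {ω | x < W 0 ω} = P.map (W 1) (Set.Ioi x) := by
          rw [h.steady 1, Measure.map_apply (h.measurable_W 0) measurableSet_Ioi]
          rfl
      _ = P.map (fun ω => (H 0 ω - A 0 ω, W 0 ω)) {p : ℝ × ℝ | x < p.1 + p.2} := by
          rw [Measure.map_apply (h.measurable_W 1) measurableSet_Ioi,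
            Measure.map_apply (hX.prodMk (h.measurable_W 0)) hset]
          congr 1 with ω
          simp only [Set.mem_preimage, Set.mem_Ioi, h.lindley, lt_max_iff, not_lt.2 hx, false_or,
            Set.mem_ofPred_eq]
          rw [show W 0 ω + H 0 ω - A 0 ω = H 0 ω - A 0 ω + W 0 ω by ring]
      _ = ∫⁻ u, P.map (W 0) (Set.Ioi (x - u)) ∂(P.map fun ω => H 0 ω - A 0 ω) := by
          rw [hprod, Measure.prod_apply hset]
          congr 1 with u
          congr 1 with w
          simp [sub_lt_iff_lt_add']
      _ = _ := by
          rw [lintegral_map hmeas hX]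
          congr 1 with ω
          rw [Measure.map_apply (h.measurable_W 0) measurableSet_Ioi]
          rfl
  rw [measureReal_def, hstep, ← integral_toReal]
  · rfl
  · refine Measurable.aemeasurable ?_
    have := hmeas.comp hX
    convert this using 2 with ω
    rw [Function.comp, Measure.map_apply (h.measurable_W 0) measurableSet_Ioi]
    rfl
  · exact Eventually.of_forall fun _ => measure_lt_top _ _

/-- The tail of the stationary waiting time in a G/M/1 queue. -/
lemma measureReal_lt_W_eq (h : IsSteadyGM1 P G μ A H W) [IsProbabilityMeasure G]
    (hG : ∀ᵐ x ∂G, 0 ≤ x) (hint : Integrable (fun x => x) G) (hμ : 0 < μ)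
    (hmean : 1 / μ < ∫ x, x ∂G) {η : ℝ} (hη : η ∈ rootSet G μ) (h1 : η < 1) {x : ℝ}
    (hx : 0 ≤ x) :
    P.real {ω | x < W 0 ω} = η * Real.exp (-(μ * (1 - η) * x)) := by
  have h0 := pos_of_mem_rootSet hG hμ hη
  set F : ℝ → ℝ := fun y => P.real {ω | y < W 0 ω} with hF
  have hFanti : Antitone F := fun y z hyz =>
    measureReal_mono fun ω (hω : z < W 0 ω) => hyz.trans_lt hω
  have hF0 : ∀ y, 0 ≤ F y := fun y => measureReal_nonneg
  have hF1 : ∀ y, F y ≤ 1 := fun y => measureReal_le_one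
  have hFneg : ∀ y, y < 0 → F y = 1 := fun y hy => by
    have : {ω | y < W 0 ω} = Set.univ :=
      Set.eq_univ_of_forall fun ω => hy.trans_le (h.W_nonneg 0 ω)
    simp [hF, this]
  have hFlim : Tendsto F atTop (𝓝 0) := by
    have := Measure.isProbabilityMeasure_map (μ := P) (h.measurable_W 0).aemeasurable
    have h2 := (tendsto_cdf_atTop (P.map (W 0))).const_sub 1
    rw [sub_self] at h2
    refine h2.congr fun y => ?_
    rw [cdf_eq_real, ← probReal_compl_eq_one_sub measurableSet_Iic, Set.compl_Iic,
      map_measureReal_apply (h.measurable_W 0) measurableSet_Ioi]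
    rfl
  have hE0 := waitingTail_nonneg (μ := μ) h0.le
  have hE1 := waitingTail_le_one hμ h1
  have hEm := measurable_waitingTail μ η
  have hXm : ∀ n, Measurable fun ω => H n ω - A n ω := fun n =>
    (h.measurable_H n).sub (h.measurable_A n)
  have hAint : Integrable (A 0) P := by
    rw [← h.law_A 0] at hint
    exact (integrable_map_measure aestronglyMeasurable_id (h.measurable_A 0).aemeasurable).1 hint
  have hAmean : ∫ ω, A 0 ω ∂P = ∫ x, x ∂G := by
    rw [← h.law_A 0, integral_map (h.measurable_A 0).aemeasurable (by fun_prop)]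
  have hH := h.integrable_H hμ 0
  have hdrift : ∫ ω, H 0 ω - A 0 ω ∂P < 0 := by
    rw [integral_sub hH.1 hAint, hH.2, hAmean]
    linarith
  -- The absolute difference is harmless on negative arguments, where both tails are 1, and
  -- elsewhere inherits subharmonicity from the two equations.
  have hle := le_zero_of_le_integral_walk (P := P) (X := fun n ω => H n ω - A n ω)
    (h := fun y => |F y - waitingTail μ η y|) hXm ?_ ?_ (hH.1.sub hAint) hdrift
    (hFanti.measurable.sub hEm).abs
    (fun y => by
      rw [abs_abs, abs_le]
      constructor <;> linarith [hF0 y, hF1 y, hE0 y, hE1 y]) ?_ ?_ x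
  · have := abs_nonpos_iff.1 hle
    rw [waitingTail, if_neg (not_lt.2 hx)] at this
    linarith
  · exact h.indep_packets.comp (fun _ p => p.2 - p.1) fun _ => by fun_prop
  · intro n
    have hlaw : ∀ n, P.map (fun ω => (A n ω, H n ω)) = G.prod (expMeasure μ) := fun n => by
      rw [(indepFun_iff_map_prod_eq_prod_map_map (h.measurable_A n).aemeasurable
        (h.measurable_H n).aemeasurable).1 (h.indep_A_H n), h.law_A, h.law_H]
    have hmap : ∀ n, P.map (fun ω => H n ω - A n ω)
        = (G.prod (expMeasure μ)).map (fun p => p.2 - p.1) := fun n => by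
      rw [← hlaw n, Measure.map_map (by fun_prop) ((h.measurable_A n).prodMk (h.measurable_H n))]
      rfl
    rw [hmap, hmap]
  · have := (hFlim.sub (tendsto_waitingTail hμ h1)).abs
    simpa using this
  · intro y
    rcases lt_or_ge y 0 with hy | hy
    · rw [hFneg y hy, waitingTail, if_pos hy, sub_self, abs_zero]
      exact integral_nonneg fun ω => abs_nonneg _
    · have hFi : Integrable (fun ω => F (y - (H 0 ω - A 0 ω))) P :=
        Integrable.of_bound
          (hFanti.measurable.comp (measurable_const.sub (hXm 0))).aestronglyMeasurable 1
          (Eventually.of_forall fun ω => by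
            rw [Real.norm_of_nonneg (hF0 _)]
            exact hF1 _)
      have hEi : Integrable (fun ω => waitingTail μ η (y - (H 0 ω - A 0 ω))) P :=
        Integrable.of_bound (hEm.comp (measurable_const.sub (hXm 0))).aestronglyMeasurable 1
          (Eventually.of_forall fun ω => by
            rw [Real.norm_of_nonneg (hE0 _)]
            exact hE1 _)
      rw [← h.integral_waitingTail hG hμ hη h1 hy, show F y = ∫ ω, F (y - (H 0 ω - A 0 ω)) ∂P from
        h.measureReal_lt_W hy, ← integral_sub hFi hEi]
      exact abs_integral_le_integral_abs

/-- The equation for the roots has exactly one root below `1`, and it is the smallest one. -/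
lemma isLeast_of_mem_rootSet (h : IsSteadyGM1 P G μ A H W) [IsProbabilityMeasure G]
    (hG : ∀ᵐ x ∂G, 0 ≤ x) (hint : Integrable (fun x => x) G) (hμ : 0 < μ)
    (hmean : 1 / μ < ∫ x, x ∂G) {η : ℝ} (hη : η ∈ rootSet G μ) (h1 : η < 1) :
    IsLeast (rootSet G μ) η := by
  refine ⟨hη, fun y hy => ?_⟩
  rcases lt_or_ge y 1 with hy1 | hy1
  · have e1 := h.measureReal_lt_W_eq hG hint hμ hmean hη h1 le_rfl
    have e2 := h.measureReal_lt_W_eq hG hint hμ hmean hy hy1 le_rfl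
    simp only [mul_zero, neg_zero, Real.exp_zero, mul_one] at e1 e2
    exact (e1.symm.trans e2).le
  · linarith

lemma smallestRoot_spec (h : IsSteadyGM1 P G μ A H W) [IsProbabilityMeasure G]
    (hG : ∀ᵐ x ∂G, 0 ≤ x) (hint : Integrable (fun x => x) G) (hμ : 0 < μ)
    (hmean : 1 / μ < ∫ x, x ∂G) :
    IsLeast (rootSet G μ) (smallestRoot G μ) ∧ smallestRoot G μ < 1 := by
  obtain ⟨η, hη, -, h1⟩ := exists_root hG hint hμ hmean
  have hl := h.isLeast_of_mem_rootSet hG hint hμ hmean hη h1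
  rw [smallestRoot, hl.csInf_eq]
  exact ⟨hl, h1⟩

/-- The mean delay in a G/M/1 queue in steady state. -/
lemma integrable_sojourn (h : IsSteadyGM1 P G μ A H W) [IsProbabilityMeasure G]
    (hG : ∀ᵐ x ∂G, 0 ≤ x) (hint : Integrable (fun x => x) G) (hμ : 0 < μ)
    (hmean : 1 / μ < ∫ x, x ∂G) {η : ℝ} (hη : η ∈ rootSet G μ) (h1 : η < 1) (n : ℕ) :
    Integrable (sojourn W H n) P ∧
      ∫ ω, sojourn W H n ω ∂P = 1 / μ + η / (μ * (1 - η)) := by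
  have hW := integrable_and_integral_of_tail (P := P) (h.measurable_W n)
    (Eventually.of_forall (h.W_nonneg n)) (pos_of_mem_rootSet hG hμ hη).le
    (mul_pos hμ (by linarith : (0 : ℝ) < 1 - η)) fun x hx => by
      rw [← h.measureReal_lt_W_eq hG hint hμ hmean hη h1 hx]
      have e : ∀ m, P.real {ω | x < W m ω} = (P.map (W m)).real (Set.Ioi x) := fun m => by
        rw [map_measureReal_apply (h.measurable_W m) measurableSet_Ioi]
        rfl
      rw [e, e, h.steady n]
  have hH := h.integrable_H hμ n
  refine ⟨hW.1.add hH.1, ?_⟩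
  simp only [sojourn]
  rw [integral_add hW.1 hH.1, hW.2, hH.2, add_comm]

end IsSteadyGM1


/-! ### Deterministic arrivals and the Lambert function. -/

lemma lambertW_mul_exp {v : ℝ} (hv : -1 ≤ v) : lambertW (v * Real.exp v) = v := by
  have hmono : StrictMonoOn (fun w : ℝ => w * Real.exp w) (Set.Ici (-1)) := by
    refine strictMonoOn_of_deriv_pos (convex_Ici _) (by fun_prop) fun w hw => ?_
    rw [interior_Ici] at hw
    have hd : HasDerivAt (fun w : ℝ => w * Real.exp w) (1 * Real.exp w + w * Real.exp w) w :=
      (hasDerivAt_id w).mul (Real.hasDerivAt_exp w)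
    rw [hd.deriv, ← add_mul]
    exact mul_pos (by linarith [Set.mem_Ioi.1 hw]) (Real.exp_pos w)
  exact hmono.injOn.leftInvOn_invFunOn (Set.mem_Ici.2 hv)

lemma laplace_dirac (c s : ℝ) : laplace (Measure.dirac c) s = Real.exp (-(s * c)) := by
  rw [laplace, integral_dirac]

/-- The root for deterministic inter-arrival times in terms of the Lambert function. -/
lemma exists_root_dirac {lam μ : ℝ} (hlam : 0 < lam) (hlt : lam < μ) :
    ∃ η ∈ rootSet (Measure.dirac (1 / lam)) μ, η < 1 ∧
      -(lam / μ) * lambertW (-(1 / (lam / μ)) * Real.exp (-(1 / (lam / μ)))) = η := by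
  have hμ : 0 < μ := hlam.trans hlt
  have hG : ∀ᵐ x ∂(Measure.dirac (1 / lam)), 0 ≤ x := by
    rw [ae_dirac_eq]
    exact (show 0 ≤ 1 / lam by positivity)
  have hρ : 0 < lam / μ := by positivity
  have hρ1 : lam / μ < 1 := (div_lt_one hμ).2 hlt
  -- The bound log ρ ≥ 1 - 1/ρ gives a root `η ≤ ρ`, not merely below 1. This places -η/ρ in [-1,
  -- ∞), the range of the principal branch.
  have hle : laplace (Measure.dirac (1 / lam)) (μ * (1 - lam / μ)) ≤ lam / μ := by
    rw [laplace_dirac, ← Real.le_log_iff_exp_le hρ]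
    have := Real.one_sub_inv_le_log_of_pos hρ
    have e : -(μ * (1 - lam / μ) * (1 / lam)) = 1 - (lam / μ)⁻¹ := by
      field_simp
      ring
    rwa [e]
  obtain ⟨η, hη, h0, hηle⟩ := exists_root_le hG hμ hρ.le hρ1 hle
  refine ⟨η, hη, hηle.trans_lt hρ1, ?_⟩
  have hroot : η = Real.exp (-(μ * (1 - η) * (1 / lam))) := by
    have : η = laplace (Measure.dirac (1 / lam)) (μ * (1 - η)) := hη
    rwa [laplace_dirac] at this
  have harg : -(1 / (lam / μ)) * Real.exp (-(1 / (lam / μ)))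
      = -(η / (lam / μ)) * Real.exp (-(η / (lam / μ))) := by
    have h2 : Real.exp (-(1 / (lam / μ))) = η * Real.exp (-(η / (lam / μ))) := by
      refine Eq.trans ?_ (congrArg (· * Real.exp (-(η / (lam / μ)))) hroot.symm)
      rw [← Real.exp_add]
      congr 1
      field_simp
      ring
    rw [h2]
    ring
  rw [harg, lambertW_mul_exp (by rw [neg_le_neg_iff, div_le_one hρ]; exact hηle)]
  field_simp

/-! ### Mean system delays and their passage to AoI. -/

section

variable {Ω : Type*} [MeasurableSpace Ω] {P : Measure Ω}

/-- Mean of a quantity selected by an independent two-valued index. -/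
lemma integrable_select {C : Ω → Fin 2} (hC : Measurable C) {D : Fin 2 → Ω → ℝ}
    (hD : ∀ i, Integrable (D i) P) (hind : ∀ i, IndepFun C (D i) P) :
    Integrable (fun ω => D (C ω) ω) P ∧
      ∫ ω, D (C ω) ω ∂P
        = P.real {ω | C ω = 0} * ∫ ω, D 0 ω ∂P + P.real {ω | C ω = 1} * ∫ ω, D 1 ω ∂P := by
  have hms : ∀ i, MeasurableSet {ω | C ω = i} := fun i => hC (measurableSet_singleton i)
  have heq : (fun ω => D (C ω) ω)
      = fun ω => {ω | C ω = 0}.indicator (D 0) ω + {ω | C ω = 1}.indicator (D 1) ω := by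
    ext ω
    generalize hc : C ω = c
    fin_cases c <;> simp [Set.indicator, hc]
  have hterm : ∀ i, ∫ ω, {ω | C ω = i}.indicator (D i) ω ∂P
      = P.real {ω | C ω = i} * ∫ ω, D i ω ∂P := by
    intro i
    have h1 := (hind i).integral_fun_comp_mul_comp (f := Set.indicator {i} 1) (g := id)
      hC.aemeasurable (hD i).aemeasurable (by fun_prop) (by fun_prop)
    have h2 : ∀ ω, Set.indicator {i} (1 : Fin 2 → ℝ) (C ω) = {ω | C ω = i}.indicator 1 ω := by
      intro ω
      simp [Set.indicator]
    simp only [h2, id] at h1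
    rw [integral_indicator_one (hms i)] at h1
    rw [← h1]
    congr 1 with ω
    simp [Set.indicator]
  have hint : ∀ i, Integrable ({ω | C ω = i}.indicator (D i)) P := fun i =>
    (hD i).indicator (hms i)
  refine ⟨heq ▸ (hint 0).add (hint 1), ?_⟩
  rw [heq, integral_add (hint 0) (hint 1), hterm, hterm]

lemma integrable_systemDelay {Φ S Dsched Dserv : ℕ → Ω → ℝ} {n : ℕ}
    (hT : Integrable (fun ω => Φ n ω / S n ω) P) (h0 : Integrable (Dsched n) P)
    (h1 : Integrable (Dserv n) P) :
    Integrable (systemDelay Φ S Dsched Dserv n) P ∧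
      ∫ ω, systemDelay Φ S Dsched Dserv n ω ∂P
        = ∫ ω, Φ n ω / S n ω ∂P + ∫ ω, Dsched n ω ∂P + ∫ ω, Dserv n ω ∂P := by
  refine ⟨(hT.add h0).add h1, ?_⟩
  simp only [systemDelay]
  rw [integral_add (f := fun ω => Φ n ω / S n ω + Dsched n ω) (hT.add h0) h1, integral_add hT h0]

variable [IsProbabilityMeasure P]

lemma integrable_sojourn_dm1 {lam μ : ℝ} (hlam : 0 < lam) (hlt : lam < μ) {H W : ℕ → Ω → ℝ}
    (h : IsSteadyDM1 P lam μ H W) (n : ℕ) :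
    Integrable (sojourn W H n) P ∧ ∫ ω, sojourn W H n ω ∂P
      = 1 / μ + (1 / μ) *
        ((-(lam / μ) * lambertW (-(1 / (lam / μ)) * Real.exp (-(1 / (lam / μ)))))
          / (1 + (lam / μ) * lambertW (-(1 / (lam / μ)) * Real.exp (-(1 / (lam / μ)))))) := by
  have hμ : 0 < μ := hlam.trans hlt
  obtain ⟨η, hη, h1, hw⟩ := exists_root_dirac hlam hlt
  have hG : ∀ᵐ x ∂(Measure.dirac (1 / lam)), 0 ≤ x := by
    rw [ae_dirac_eq]
    exact (show 0 ≤ 1 / lam by positivity)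
  have hmean : 1 / μ < ∫ x, x ∂(Measure.dirac (1 / lam)) := by
    rw [integral_dirac]
    exact one_div_lt_one_div_of_lt hlam hlt
  have hD := IsSteadyGM1.integrable_sojourn h hG (integrable_dirac (by simp)) hμ hmean hη h1 n
  refine ⟨hD.1, hD.2.trans ?_⟩
  set w := lambertW (-(1 / (lam / μ)) * Real.exp (-(1 / (lam / μ))))
  have hden : 1 + lam / μ * w = 1 - η := by linarith
  rw [hw, hden]
  have : 1 - η ≠ 0 := by linarith
  field_simp

lemma meanArea_mul {lam : ℝ} (hlam : 0 < lam) {D : ℕ → Ω → ℝ} {n : ℕ}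
    (hD : Integrable (D (n + 1)) P) :
    meanArea P lam D n * lam = 1 / (2 * lam) + ∫ ω, D (n + 1) ω ∂P := by
  simp only [meanArea, polygonArea_eq, genInterval_eq]
  rw [integral_add (integrable_const _) (hD.const_mul _), integral_const_mul]
  simp
  field_simp

lemma averageAoI_eq {lam : ℝ} (hlam : 0 < lam) {D : ℕ → Ω → ℝ} {n : ℕ}
    (hD : Integrable (D (n + 1)) P) :
    averageAoI P lam D n = 1 / (2 * lam) + ∫ ω, D (n + 1) ω ∂P := by
  rw [← meanArea_mul hlam hD, averageAoI]
  simp [genInterval_eq]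

lemma ae_tendsto_timeAverageAge {lam : ℝ} (hlam : 0 < lam) {D : ℕ → Ω → ℝ}
    (hD : ∀ n, 0 ≤ᵐ[P] D n) (hint : Integrable (D 1) P) (hord : DeparturesOrdered P lam D)
    (herg : AreasErgodic P lam D) :
    ∀ᵐ ω ∂P, Tendsto (timeAverageAge lam fun n => D n ω) atTop
      (𝓝 (1 / (2 * lam) + ∫ ω, D 1 ω ∂P)) := by
  filter_upwards [ae_all_iff.2 hD, hord, herg] with ω h0 hmono hq
  rw [← meanArea_mul (n := 0) hlam hint]
  exact tendsto_timeAverageAge hlam h0 hmono hq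

end

lemma measurable_category (ξhat : ℝ) : Measurable (category ξhat) :=
  Measurable.ite measurableSet_Ici measurable_const measurable_const

end AoI

/-! ### Assembly of the formulas. -/

theorem mainTheorem1
    {Ω : Type*} [MeasurableSpace Ω] (P : Measure Ω) [IsProbabilityMeasure P]
    -- rates of the scheduler (a D/M/1 queue)
    (lam₀ μ₀ : ℝ) (hlam₀ : 0 < lam₀) (hρ₀ : lam₀ < μ₀)
    -- inter-arrival laws and rates of the two servers (G/M/1 queues)
    (G : Fin 2 → Measure ℝ) [∀ i, IsProbabilityMeasure (G i)]
    (hG : ∀ i, ∀ᵐ x ∂(G i), 0 ≤ x)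
    (lam μ : Fin 2 → ℝ) (hlam : ∀ i, 0 < lam i)
    (hmean : ∀ i, ∫ x, x ∂(G i) = 1 / lam i) (hρ : ∀ i, lam i < μ i)
    -- the three queues, in steady state
    (H₀ W₀ : ℕ → Ω → ℝ) (hsched : AoI.IsSteadyDM1 P lam₀ μ₀ H₀ W₀)
    (A H W : Fin 2 → ℕ → Ω → ℝ)
    (hserv : ∀ i, AoI.IsSteadyGM1 P (G i) (μ i) (A i) (H i) (W i))
    -- packet volumes and semantic rates, with constant mean transmission time
    (Φ S : ℕ → Ω → ℝ) (hΦm : ∀ n, Measurable (Φ n)) (hSm : ∀ n, Measurable (S n))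
    (hΦ : ∀ n ω, 0 ≤ Φ n ω) (hS : ∀ n ω, 0 < S n ω)
    (hT : ∀ n, Integrable (fun ω => Φ n ω / S n ω) P)
    (hTconst : ∀ n, ∫ ω, Φ n ω / S n ω ∂P = ∫ ω, Φ 0 ω / S 0 ω ∂P)
    -- semantic similarities and the proportions of the two categories
    (ξ : ℕ → Ω → ℝ) (ξhat : ℝ) (hξm : ∀ n, Measurable (ξ n))
    (a b : ℝ) (hab : a + b = 1)
    (ha : ∀ n, P.real {ω | AoI.category ξhat (ξ n ω) = 0} = a)
    (hcat : ∀ i n, IndepFun (fun ω => AoI.category ξhat (ξ n ω))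
      (AoI.sojourn (W i) (H i) n) P) :
    let ρ₀ : ℝ := lam₀ / μ₀
    let w : ℝ := AoI.lambertW (-(1 / ρ₀) * Real.exp (-(1 / ρ₀)))
    let η : Fin 2 → ℝ := fun i => AoI.smallestRoot (G i) (μ i)
    let D₀ : ℕ → Ω → ℝ := AoI.sojourn W₀ H₀
    let Ds : Fin 2 → ℕ → Ω → ℝ := fun i => AoI.sojourn (W i) (H i)
    -- system delay of the updates on the path through server `i`
    let Dpath : Fin 2 → ℕ → Ω → ℝ := fun i => AoI.systemDelay Φ S D₀ (Ds i)
    -- system delay over all updates, each one being served according to its category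
    let Dall : ℕ → Ω → ℝ :=
      AoI.systemDelay Φ S D₀ (fun n ω => Ds (AoI.category ξhat (ξ n ω)) n ω)
    let Δ : Fin 2 → ℝ := fun i =>
      1 / (2 * lam₀) + ∫ ω, Φ 0 ω / S 0 ω ∂P + (μ₀ + μ i) / (μ₀ * μ i)
        + (1 / μ₀) * ((-ρ₀ * w) / (1 + ρ₀ * w)) + η i / (μ i * (1 - η i))
    -- the roots `η i` exist and are smaller than `1`
    (∀ i, IsLeast (AoI.rootSet (G i) (μ i)) (η i) ∧ η i < 1) ∧
    -- mean delay in the scheduler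
    (∀ n, Integrable (D₀ n) P ∧
      ∫ ω, D₀ n ω ∂P = 1 / μ₀ + (1 / μ₀) * ((-ρ₀ * w) / (1 + ρ₀ * w))) ∧
    -- mean delay in each server
    (∀ i n, Integrable (Ds i n) P ∧
      ∫ ω, Ds i n ω ∂P = 1 / μ i + η i / (μ i * (1 - η i))) ∧
    -- average AoI of the two categories
    (∀ i n, Integrable (Dpath i n) P ∧
      AoI.averageAoI P lam₀ (Dpath i) n
        = 1 / (2 * lam₀) + ∫ ω, Φ n ω / S n ω ∂P + ∫ ω, D₀ n ω ∂P + ∫ ω, Ds i n ω ∂P ∧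
      AoI.averageAoI P lam₀ (Dpath i) n = Δ i) ∧
    -- overall average AoI
    (∀ n, Integrable (Dall n) P ∧
      AoI.averageAoI P lam₀ Dall n
        = a * AoI.averageAoI P lam₀ (Dpath 0) n + b * AoI.averageAoI P lam₀ (Dpath 1) n ∧
      AoI.averageAoI P lam₀ Dall n = a * Δ 0 + b * Δ 1) ∧
    -- under ordered departures and ergodicity, these are the time averages of the age
    (∀ i, AoI.DeparturesOrdered P lam₀ (Dpath i) → AoI.AreasErgodic P lam₀ (Dpath i) →
      ∀ᵐ ω ∂P, Tendsto (AoI.timeAverageAge lam₀ (fun n => Dpath i n ω)) atTop (𝓝 (Δ i))) ∧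
    (AoI.DeparturesOrdered P lam₀ Dall → AoI.AreasErgodic P lam₀ Dall →
      ∀ᵐ ω ∂P, Tendsto (AoI.timeAverageAge lam₀ (fun n => Dall n ω)) atTop
        (𝓝 (a * Δ 0 + b * Δ 1))) := by
  intro ρ₀ w η D₀ Ds Dpath Dall Δ
  have hμ : ∀ i, 0 < μ i := fun i => (hlam i).trans (hρ i)
  have hμ₀ : 0 < μ₀ := hlam₀.trans hρ₀
  have hGint : ∀ i, Integrable (fun x => x) (G i) := fun i => by
    -- A non-integrable function has integral 0 by convention, contradicting the positive mean.
    by_contra hn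
    have h := hmean i
    rw [integral_undef hn] at h
    exact absurd h (one_div_pos.2 (hlam i)).ne
  have hGmean : ∀ i, 1 / μ i < ∫ x, x ∂(G i) := fun i => by
    rw [hmean i]
    exact one_div_lt_one_div_of_lt (hlam i) (hρ i)
  have hη : ∀ i, IsLeast (AoI.rootSet (G i) (μ i)) (η i) ∧ η i < 1 := fun i =>
    (hserv i).smallestRoot_spec (hG i) (hGint i) (hμ i) (hGmean i)
  have hD₀ : ∀ n, Integrable (D₀ n) P ∧
      ∫ ω, D₀ n ω ∂P = 1 / μ₀ + (1 / μ₀) * ((-ρ₀ * w) / (1 + ρ₀ * w)) :=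
    AoI.integrable_sojourn_dm1 hlam₀ hρ₀ hsched
  have hDs : ∀ i n, Integrable (Ds i n) P ∧
      ∫ ω, Ds i n ω ∂P = 1 / μ i + η i / (μ i * (1 - η i)) := fun i =>
    (hserv i).integrable_sojourn (hG i) (hGint i) (hμ i) (hGmean i) (hη i).1.1 (hη i).2
  have hDpath : ∀ i n, Integrable (Dpath i n) P ∧ ∫ ω, Dpath i n ω ∂P
      = ∫ ω, Φ n ω / S n ω ∂P + ∫ ω, D₀ n ω ∂P + ∫ ω, Ds i n ω ∂P := fun i n =>
    AoI.integrable_systemDelay (hT n) (hD₀ n).1 (hDs i n).1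
  have hΔ : ∀ i n, 1 / (2 * lam₀) + ∫ ω, Dpath i n ω ∂P = Δ i := fun i n => by
    rw [(hDpath i n).2, hTconst, (hD₀ n).2, (hDs i n).2]
    have : (μ₀ + μ i) / (μ₀ * μ i) = 1 / μ₀ + 1 / μ i := by
      have := (hμ i).ne'
      field_simp
      ring
    simp only [Δ]
    rw [this]
    ring
  have hb : ∀ n, P.real {ω | AoI.category ξhat (ξ n ω) = 1} = b := fun n => by
    have hm : MeasurableSet {ω | AoI.category ξhat (ξ n ω) = 0} :=
      (AoI.measurable_category ξhat).comp (hξm n) (measurableSet_singleton 0)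
    have hc : {ω | AoI.category ξhat (ξ n ω) = 1} = {ω | AoI.category ξhat (ξ n ω) = 0}ᶜ := by
      ext ω
      simp only [Set.mem_ofPred_eq, Set.mem_compl_iff]
      omega
    rw [hc, probReal_compl_eq_one_sub hm, ha n]
    linarith
  have hsel : ∀ n, Integrable (fun ω => Ds (AoI.category ξhat (ξ n ω)) n ω) P ∧
      ∫ ω, Ds (AoI.category ξhat (ξ n ω)) n ω ∂P
        = a * ∫ ω, Ds 0 n ω ∂P + b * ∫ ω, Ds 1 n ω ∂P := fun n => by
    have h := AoI.integrable_select ((AoI.measurable_category ξhat).comp (hξm n))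
      (D := fun i => Ds i n) (fun i => (hDs i n).1) (fun i => hcat i n)
    refine ⟨h.1, h.2.trans ?_⟩
    rw [← ha n, ← hb n]
    rfl
  have hDall : ∀ n, Integrable (Dall n) P ∧ ∫ ω, Dall n ω ∂P
      = a * ∫ ω, Dpath 0 n ω ∂P + b * ∫ ω, Dpath 1 n ω ∂P := fun n => by
    have h := AoI.integrable_systemDelay
      (Dserv := fun n ω => Ds (AoI.category ξhat (ξ n ω)) n ω) (hT n) (hD₀ n).1 (hsel n).1
    refine ⟨h.1, h.2.trans ?_⟩
    rw [(hsel n).2, (hDpath 0 n).2, (hDpath 1 n).2]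
    -- Transmission and scheduler delays are common to both paths, so a + b = 1 distributes them.
    linear_combination (-(∫ ω, Φ n ω / S n ω ∂P) - ∫ ω, D₀ n ω ∂P) * hab
  have hall : ∀ n, 1 / (2 * lam₀) + ∫ ω, Dall n ω ∂P = a * Δ 0 + b * Δ 1 := fun n => by
    rw [(hDall n).2, ← hΔ 0 n, ← hΔ 1 n]
    linear_combination -(1 / (2 * lam₀)) * hab
  have hD₀nn : ∀ n, 0 ≤ᵐ[P] D₀ n := fun n => by
    filter_upwards [AoI.IsSteadyGM1.H_nonneg hsched hμ₀ n] with ω hω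
    exact add_nonneg (AoI.IsSteadyGM1.W_nonneg hsched n ω) hω
  have hDsnn : ∀ i n, 0 ≤ᵐ[P] Ds i n := fun i n => by
    filter_upwards [(hserv i).H_nonneg (hμ i) n] with ω hω
    exact add_nonneg ((hserv i).W_nonneg n ω) hω
  have hTnn : ∀ n ω, 0 ≤ Φ n ω / S n ω := fun n ω => div_nonneg (hΦ n ω) (hS n ω).le
  refine ⟨hη, hD₀, hDs, fun i n => ⟨(hDpath i n).1, ?_, ?_⟩,
    fun n => ⟨(hDall n).1, ?_, ?_⟩, fun i hord herg => ?_, fun hord herg => ?_⟩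
  -- The area at index `n` uses the delay of update `n + 1`; its mean is the same as for update `n`.
  · rw [AoI.averageAoI_eq hlam₀ (hDpath i (n + 1)).1, hΔ, ← hΔ i n, (hDpath i n).2]
    ring
  · rw [AoI.averageAoI_eq hlam₀ (hDpath i (n + 1)).1, hΔ]
  · rw [AoI.averageAoI_eq hlam₀ (hDall (n + 1)).1, AoI.averageAoI_eq hlam₀ (hDpath 0 (n + 1)).1,
      AoI.averageAoI_eq hlam₀ (hDpath 1 (n + 1)).1, hall, hΔ, hΔ]
  · rw [AoI.averageAoI_eq hlam₀ (hDall (n + 1)).1, hall]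
  · rw [← hΔ i 1]
    refine AoI.ae_tendsto_timeAverageAge hlam₀ (fun n => ?_) (hDpath i 1).1 hord herg
    filter_upwards [hD₀nn n, hDsnn i n] with ω h0 h1
    exact add_nonneg (add_nonneg (hTnn n ω) h0) h1
  · rw [← hall 1]
    refine AoI.ae_tendsto_timeAverageAge hlam₀ (fun n => ?_) (hDall 1).1 hord herg
    -- The server varies with `ω`, so nonnegativity is taken for both servers at once.
    filter_upwards [hD₀nn n, ae_all_iff.2 fun i => hDsnn i n] with ω h0 h1
    exact add_nonneg (add_nonneg (hTnn n ω) h0) (h1 _)
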